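/- Let $G$ be a locally compact (Hausdorff) group, with left Haar measure and left regular representation $\lambda$ on $L^2(G)$, $(\lambda(g)\xi)(s)=\xi(g^{-1}s)$. Let $A(G)$ be the Fourier algebra of $G$: the space of all functions $u:G\to\mathbb{C}$ of the form $u(g)=\sum_{n}\langle\lambda(g)\xi_n\,|\,\eta_n\rangle$ with $\xi_n,\eta_n\in L^2(G)$ and $\sum_n\|\xi_n\|_2\|\eta_n\|_2<\infty$, normed by the infimum of $\sum_n\|\xi_n\|_2\|\eta_n\|_2$ over all such representations of $u$ (equivalently, the space of all single matrix coefficients $u=\langle\lambda(\cdot)\xi\,|\,\eta\rangle$, normed by the infimum of $\|\xi\|_2\|\eta\|_2$). Let $A_c(G)$ be the set of $u\in A(G)$ whose support $\operatorname{supp}u=\overline{\{g\in G:u(g)\neq 0\}}$ is compact. For a closed set $E\subseteq G$ put $$I_G(E)=\{u\in A(G):u|_E=0\},\qquad I_G^0(E)=\{u\in A_c(G):\operatorname{supp}u\cap E=\varnothing\},\qquad J_G(E)=\overline{I_G(E)\cap A_c(G)},$$ where closures are taken in the norm of $A(G)$, and say that $E$ is of local synthesis for $G$ if $\overline{I_G^0(E)}=J_G(E)$.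 Proposition. Let $E\subseteq G$ be a closed subset which admits a partition $E=\bigsqcup_{i\in I}E_i$ (with $I$ an arbitrary index set) for which each $E_i$ is closed in $G$ and relatively open in $E$. Then $E$ is of local synthesis for $G$ if and only if each $E_i$ is of local synthesis for $G$. -/

import Mathlib

/-! The Fourier algebra `A(G)` of a locally compact group and sets of local synthesis. -/

noncomputable section

open MeasureTheory

section FourierAlgebra

variable (G : Type*) [Group G] [TopologicalSpace G] [IsTopologicalGroup G] [LocallyCompactSpace G]
  [MeasurableSpace G] [BorelSpace G]

/-- The Hilbert space `L²(G)` for left Haar measure. -/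
abbrev HaarL2 : Type _ := Lp ℂ 2 (Measure.haar : Measure G)

variable {G}

/-- The left regular representation: `(λ(g) ξ)(s) = ξ(g⁻¹ s)` on `L²(G)`. -/
def leftRegular (g : G) : HaarL2 G →ₗᵢ[ℂ] HaarL2 G :=
  Lp.compMeasurePreservingₗᵢ ℂ (fun s : G => g⁻¹ * s)
    (measurePreserving_mul_left (Measure.haar : Measure G) g⁻¹)

/-- The matrix coefficient `g ↦ ⟨λ(g) ξ | η⟩` of the left regular representation
(here `⟨· | ·⟩` is linear in the first variable; Mathlib's `inner` is linear in the second). -/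
def regularCoeff (ξ η : HaarL2 G) (g : G) : ℂ := inner ℂ η (leftRegular g ξ)

/-- `IsFourierSeries u ξ η`: the series `∑ₙ ‖ξₙ‖₂ ‖ηₙ‖₂` converges, and
`u(g) = ∑ₙ ⟨λ(g) ξₙ | ηₙ⟩` for every `g`. -/
structure IsFourierSeries (u : G → ℂ) (ξ η : ℕ → HaarL2 G) : Prop where
  summable : Summable fun n => ‖ξ n‖ * ‖η n‖
  hasSum : ∀ g, HasSum (fun n => regularCoeff (ξ n) (η n) g) (u g)

theorem IsFourierSeries.zero : IsFourierSeries (0 : G → ℂ) 0 0 where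
  summable := by simp
  hasSum g := by simp [regularCoeff]

theorem IsFourierSeries.smul {u : G → ℂ} {ξ η : ℕ → HaarL2 G} (h : IsFourierSeries u ξ η)
    (c : ℂ) : IsFourierSeries (c • u) (c • ξ) η where
  summable := by
    simpa [norm_smul, mul_assoc] using h.summable.mul_left ‖c‖
  hasSum g := by
    simpa [regularCoeff, inner_smul_right] using (h.hasSum g).mul_left c

/-- Two sequences merged into one, through a bijection `ℕ ⊕ ℕ ≃ ℕ`. -/
def mergeSeq {α : Type*} (a b : ℕ → α) (n : ℕ) : α :=
  Sum.elim a b (Equiv.natSumNatEquivNat.symm n)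

theorem hasSum_mergeSeq {α M : Type*} [AddCommMonoid M] [TopologicalSpace M] [ContinuousAdd M]
    (f : α → α → M) {a b a' b' : ℕ → α} {x y : M}
    (h : HasSum (fun n => f (a n) (a' n)) x) (k : HasSum (fun n => f (b n) (b' n)) y) :
    HasSum (fun n => f (mergeSeq a b n) (mergeSeq a' b' n)) (x + y) := by
  rw [← Equiv.natSumNatEquivNat.hasSum_iff]
  apply HasSum.sum
  · simpa [mergeSeq, Function.comp_def] using h
  · simpa [mergeSeq, Function.comp_def] using k

theorem IsFourierSeries.add {u v : G → ℂ} {ξ η ξ' η' : ℕ → HaarL2 G}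
    (h : IsFourierSeries u ξ η) (k : IsFourierSeries v ξ' η') :
    IsFourierSeries (u + v) (mergeSeq ξ ξ') (mergeSeq η η') where
  summable := (hasSum_mergeSeq (fun x y : HaarL2 G => ‖x‖ * ‖y‖)
    h.summable.hasSum k.summable.hasSum).summable
  hasSum g := hasSum_mergeSeq (fun x y => regularCoeff x y g) (h.hasSum g) (k.hasSum g)

theorem norm_regularCoeff_le (ξ η : HaarL2 G) (g : G) : ‖regularCoeff ξ η g‖ ≤ ‖ξ‖ * ‖η‖ := by
  have := norm_inner_le_norm (𝕜 := ℂ) η (leftRegular g ξ)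
  rwa [LinearIsometry.norm_map, mul_comm] at this

theorem IsFourierSeries.norm_le {u : G → ℂ} {ξ η : ℕ → HaarL2 G} (h : IsFourierSeries u ξ η)
    (g : G) : ‖u g‖ ≤ ∑' n, ‖ξ n‖ * ‖η n‖ := by
  rw [← (h.hasSum g).tsum_eq]
  exact tsum_of_norm_bounded h.summable.hasSum fun n => norm_regularCoeff_le _ _ _

variable (G)

/-- The functions `u = ∑ₙ ⟨λ(·) ξₙ | ηₙ⟩` with `∑ₙ ‖ξₙ‖₂ ‖ηₙ‖₂ < ∞`, that is, the functions
`g ↦ ω(λ(g))` for `ω` in the predual of the group von Neumann algebra `VN(G)`. (Since `VN(G)` is in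
standard form on `L²(G)`, these are also the single coefficients `⟨λ(·) ξ | η⟩`, and the norm below
is then the infimum of `‖ξ‖₂ ‖η‖₂`; the series make linearity of the space and the triangle
inequality immediate.) -/
def fourierSubmodule : Submodule ℂ (G → ℂ) where
  carrier := {u | ∃ ξ η : ℕ → HaarL2 G, IsFourierSeries u ξ η}
  zero_mem' := ⟨0, 0, .zero⟩
  add_mem' := by
    rintro u v ⟨ξ, η, h⟩ ⟨ξ', η', k⟩
    exact ⟨_, _, h.add k⟩
  smul_mem' := by
    rintro c u ⟨ξ, η, h⟩
    exact ⟨_, _, h.smul c⟩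

/-- The Fourier algebra `A(G)`, with the norm given below. (It is a separate type, so that it does
not inherit the topology of pointwise convergence from `G → ℂ`.) -/
def FourierAlgebra : Type _ := ↥(fourierSubmodule G)

namespace FourierAlgebra

instance : AddCommGroup (FourierAlgebra G) := inferInstanceAs (AddCommGroup ↥(fourierSubmodule G))

instance : Module ℂ (FourierAlgebra G) := inferInstanceAs (Module ℂ ↥(fourierSubmodule G))

instance : CoeFun (FourierAlgebra G) (fun _ => G → ℂ) := ⟨Subtype.val⟩

variable {G}

/-- The values `∑ₙ ‖ξₙ‖₂ ‖ηₙ‖₂` over all representations `u = ∑ₙ ⟨λ(·) ξₙ | ηₙ⟩`. -/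
def normValues (u : FourierAlgebra G) : Set ℝ :=
  {r | ∃ ξ η : ℕ → HaarL2 G, IsFourierSeries u ξ η ∧ r = ∑' n, ‖ξ n‖ * ‖η n‖}

theorem normValues_nonempty (u : FourierAlgebra G) : (normValues u).Nonempty := by
  obtain ⟨ξ, η, h⟩ := u.2
  exact ⟨_, ξ, η, h, rfl⟩

theorem nonneg_of_mem_normValues {u : FourierAlgebra G} {r : ℝ} (hr : r ∈ normValues u) :
    0 ≤ r := by
  obtain ⟨ξ, η, -, rfl⟩ := hr
  exact tsum_nonneg fun n => by positivity

theorem bddBelow_normValues (u : FourierAlgebra G) : BddBelow (normValues u) :=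
  ⟨0, fun _ hr => nonneg_of_mem_normValues hr⟩

theorem add_mem_normValues {u v : FourierAlgebra G} {r s : ℝ} (hr : r ∈ normValues u)
    (hs : s ∈ normValues v) : r + s ∈ normValues (u + v) := by
  obtain ⟨ξ, η, h, rfl⟩ := hr
  obtain ⟨ξ', η', k, rfl⟩ := hs
  exact ⟨_, _, h.add k, ((hasSum_mergeSeq (fun x y : HaarL2 G => ‖x‖ * ‖y‖)
    h.summable.hasSum k.summable.hasSum).tsum_eq).symm⟩

theorem neg_mem_normValues {u : FourierAlgebra G} {r : ℝ} (hr : r ∈ normValues u) :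
    r ∈ normValues (-u) := by
  obtain ⟨ξ, η, h, rfl⟩ := hr
  refine ⟨(-1 : ℂ) • ξ, η, ?_, by simp⟩
  have := h.smul (-1)
  rw [neg_one_smul] at this
  exact this

/-- The norm of `A(G)`: `‖u‖ = inf {∑ₙ ‖ξₙ‖₂ ‖ηₙ‖₂ : u = ∑ₙ ⟨λ(·) ξₙ | ηₙ⟩}`. -/
def fourierNorm : AddGroupNorm (FourierAlgebra G) where
  toFun u := sInf (normValues u)
  map_zero' := le_antisymm
    (csInf_le (bddBelow_normValues 0) ⟨0, 0, .zero, by simp⟩)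
    (Real.sInf_nonneg fun _ hr => nonneg_of_mem_normValues hr)
  add_le' u v := by
    refine le_of_forall_pos_lt_add fun ε hε => ?_
    obtain ⟨r, hr, hr'⟩ := Real.lt_sInf_add_pos (normValues_nonempty u) (half_pos hε)
    obtain ⟨s, hs, hs'⟩ := Real.lt_sInf_add_pos (normValues_nonempty v) (half_pos hε)
    have := csInf_le (bddBelow_normValues (u + v)) (add_mem_normValues hr hs)
    linarith
  neg' u := by
    have : normValues (-u) = normValues u :=
      Set.Subset.antisymm (fun r hr => by simpa using neg_mem_normValues hr)
        fun r hr => neg_mem_normValues hr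
    rw [this]
  eq_zero_of_map_eq_zero' u hu := by
    apply Subtype.ext
    funext g
    have h : ‖u.1 g‖ ≤ sInf (normValues u) := by
      refine le_csInf (normValues_nonempty u) ?_
      rintro r ⟨ξ, η, h, rfl⟩
      exact h.norm_le g
    rw [show sInf (normValues u) = 0 from hu] at h
    exact norm_le_zero_iff.mp h

instance : NormedAddCommGroup (FourierAlgebra G) := fourierNorm.toNormedAddCommGroup

variable (G) in
/-- `A_c(G)`: the elements of `A(G)` with compact support. -/
def compactlySupported : Set (FourierAlgebra G) := {u | HasCompactSupport (u : G → ℂ)}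

/-- `I_G(E)`: the elements of `A(G)` that vanish on `E`. -/
def vanishing (E : Set G) : Set (FourierAlgebra G) := {u | ∀ g ∈ E, u g = 0}

/-- `I⁰_G(E)`: the elements of `A_c(G)` whose support is disjoint from `E`. -/
def supportedOff (E : Set G) : Set (FourierAlgebra G) :=
  {u | u ∈ compactlySupported G ∧ tsupport (u : G → ℂ) ∩ E = ∅}

/-- `J_G(E)`: the closure in `A(G)` of `I_G(E) ∩ A_c(G)`. -/
def closedVanishing (E : Set G) : Set (FourierAlgebra G) :=
  closure (vanishing E ∩ compactlySupported G)

end FourierAlgebra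

/-- A (closed) set `E` is of local synthesis for `G` if the closure of `I⁰_G(E)` is `J_G(E)`. -/
def IsLocalSynthesis {G : Type*} [Group G] [TopologicalSpace G] [IsTopologicalGroup G]
    [LocallyCompactSpace G] [MeasurableSpace G] [BorelSpace G] (E : Set G) : Prop :=
  closure (FourierAlgebra.supportedOff E) = FourierAlgebra.closedVanishing E

end FourierAlgebra

end

open MeasureTheory Topology Set
open scoped Pointwise

-- Hilbert space and L² preliminaries.

universe u

/-! Since `F i` is clopen in `E`, both `F i` and `E \ F i` are closed, so the problem localizes once
`A(G)` has multipliers `w` equal to 1 near a compact set and supported in a given neighbourhood of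
it. Take `w = 1` near `supp u ∩ F i` with `supp w` off `E \ F i`, and split `u = wu + (u - wu)`: on
`E`, `wu` sees only `F i`, while `supp (u - wu)` misses `F i`. If `E` is of local synthesis, this
settles `F i`. Conversely, compactness leaves finitely many pieces meeting `supp u`, and they are
split off one at a time (`exists_localization`, `mem_closure_supportedOff_of_finset_cover`).

The multipliers are `w(g) = μ(K'V ∩ gV) / μ(V)`. Their boundedness is Fell absorption
(`exists_hasSum_regularCoeff_mul`): integrating `⟨λ(s⁻¹)λ(g)f | λ(s⁻¹)h⟩ = ⟨λ(g)f | h⟩` over `s ∈ L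
∩ gV` and expanding in an orthonormal family gives a series of coefficients of `λ`, controlled by
Bessel and Cauchy–Schwarz. -/

/-- A separable set in a Hilbert space lies in the closed span of a countable orthonormal family. -/
theorem exists_countable_orthonormal_hasSum_inner {H : Type u} [NormedAddCommGroup H]
    [InnerProductSpace ℂ H] [CompleteSpace H] {S : Set H}
    (hS : TopologicalSpace.IsSeparable S) :
    ∃ (ι : Type u) (_ : Countable ι) (e : ι → H), Orthonormal ℂ e ∧
      ∀ x ∈ S, ∀ y, HasSum (fun i => inner ℂ x (e i) * inner ℂ (e i) y) (inner ℂ x y) := by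
  set M : Submodule ℂ H := (Submodule.span ℂ S).topologicalClosure with hM
  have hsepM : TopologicalSpace.IsSeparable (M : Set H) := (hS.span (R := ℂ)).closure
  have : TopologicalSpace.SeparableSpace M := hsepM.separableSpace
  have : CompleteSpace M := (Submodule.isClosed_topologicalClosure _).completeSpace_coe
  obtain ⟨w, b, -⟩ := exists_hilbertBasis ℂ M
  -- Distinct basis vectors are √2 apart, so balls of radius 1/2 about them are disjoint;
  -- separability allows only countably many.
  have hc : Countable w := by
    have hd : ∀ i j : w, i ≠ j → 1 ≤ dist (b i) (b j) := by
      intro i j hij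
      have h1 : ‖b i - b j‖ ^ 2 = 2 := by
        rw [@norm_sub_sq ℂ, b.orthonormal.1, b.orthonormal.1, b.orthonormal.2 hij]
        norm_num
      rw [dist_eq_norm]
      nlinarith [norm_nonneg (b i - b j)]
    have hdisj : Pairwise fun i j : w =>
        Disjoint (Metric.ball (b i) (1 / 2)) (Metric.ball (b j) (1 / 2)) := fun i j hij =>
      Metric.ball_disjoint_ball (by linarith [hd i j hij])
    exact hdisj.countable_of_isOpen_disjoint (fun _ => Metric.isOpen_ball)
      fun i => ⟨b i, Metric.mem_ball_self (by norm_num)⟩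
  refine ⟨w, hc, fun i => (b i : H), b.orthonormal.comp_linearIsometry M.subtypeₗᵢ,
    fun x hx y => ?_⟩
  have hxM : x ∈ M := Submodule.le_topologicalClosure _ (Submodule.subset_span hx)
  -- Parseval in `M`; projecting `y` to `M` does not change its inner products with vectors of `M`.
  have := b.hasSum_inner_mul_inner ⟨x, hxM⟩ (M.orthogonalProjectionOnto y)
  simp only [Submodule.inner_orthogonalProjectionOnto_eq_of_mem_left] at this
  simpa only [Submodule.coe_inner] using this

theorem norm_sq_eq_integral_norm_sq {X : Type*} [MeasurableSpace X] {μ : Measure X} (f : Lp ℂ 2 μ) :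
    ‖f‖ ^ 2 = ∫ s, ‖f s‖ ^ 2 ∂μ := by
  have h : ((‖f‖ ^ 2 : ℝ) : ℂ) = ∫ s, ((‖f s‖ ^ 2 : ℝ) : ℂ) ∂μ := by
    have h1 : ((‖f‖ ^ 2 : ℝ) : ℂ) = inner ℂ f f := by simp [inner_self_eq_norm_sq_to_K]
    have h2 (z : ℂ) : ((‖z‖ ^ 2 : ℝ) : ℂ) = inner ℂ z z := by
      rw [inner_self_eq_norm_sq_to_K]
      simp
    simp_rw [h1, h2]
    exact L2.inner_def f f
  rw [integral_complex_ofReal] at h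
  exact_mod_cast h

theorem integral_norm_inner_le {X : Type*} [MeasurableSpace X] {μ : Measure X} (f g : Lp ℂ 2 μ) :
    ∫ s, ‖(inner ℂ (f s) (g s) : ℂ)‖ ∂μ ≤ ‖f‖ ^ 2 + ‖g‖ ^ 2 := by
  have hf := (memLp_two_iff_integrable_sq_norm (Lp.memLp f).1).1 (Lp.memLp f)
  have hg := (memLp_two_iff_integrable_sq_norm (Lp.memLp g).1).1 (Lp.memLp g)
  rw [norm_sq_eq_integral_norm_sq, norm_sq_eq_integral_norm_sq, ← integral_add hf hg]
  refine integral_mono_of_nonneg (.of_forall fun s => norm_nonneg _) (hf.add hg)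
    (.of_forall fun s => ?_)
  have := norm_inner_le_norm (𝕜 := ℂ) (f s) (g s)
  beta_reduce
  nlinarith [sq_nonneg (‖f s‖ - ‖g s‖), sq_nonneg ‖f s‖, sq_nonneg ‖g s‖]

/-! ### Square-integrable coefficients of a bounded continuous vector-valued map. -/

section Coefficients

variable {X H : Type*} [TopologicalSpace X] [MeasurableSpace X] [BorelSpace X] {μ : Measure X}
  [NormedAddCommGroup H] [InnerProductSpace ℂ H]

theorem memLp_indicator_inner {c : X → H} (hc : Continuous c) {R : ℝ} (hR : ∀ s, ‖c s‖ ≤ R)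
    {W : Set X} (hW : MeasurableSet W) (hμ : μ W ≠ ⊤) (x : H) :
    MemLp (W.indicator fun s => inner ℂ x (c s)) 2 μ := by
  have : IsFiniteMeasure (μ.restrict W) := ⟨by simpa using hμ.lt_top⟩
  rw [memLp_indicator_iff_restrict hW]
  refine MemLp.of_bound (continuous_const.inner hc).aestronglyMeasurable (‖x‖ * R) ?_
  refine .of_forall fun s => (norm_inner_le_norm _ _).trans ?_
  gcongr
  exact hR s

/-- Bessel's inequality, integrated over a set of finite measure. -/
theorem sum_norm_sq_toLp_le {c : X → H} (hc : Continuous c) {R : ℝ} (hR : ∀ s, ‖c s‖ ≤ R)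
    {W : Set X} (hW : MeasurableSet W) (hμ : μ W ≠ ⊤) {ι : Type*} {e : ι → H}
    (he : Orthonormal ℂ e) (t : Finset ι) :
    ∑ i ∈ t, ‖(memLp_indicator_inner hc hR hW hμ (e i)).toLp _‖ ^ 2 ≤ μ.real W * R ^ 2 := by
  have hi : ∀ i, ‖(memLp_indicator_inner hc hR hW hμ (e i)).toLp _‖ ^ 2 =
      ∫ s, ‖W.indicator (fun s => inner ℂ (e i) (c s)) s‖ ^ 2 ∂μ := fun i => by
    rw [norm_sq_eq_integral_norm_sq]
    refine integral_congr_ae ?_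
    filter_upwards [(memLp_indicator_inner hc hR hW hμ (e i)).coeFn_toLp] with s hs
    rw [hs]
  simp_rw [hi]
  rw [← integral_finsetSum]
  · calc _ ≤ ∫ s, W.indicator (fun _ => R ^ 2) s ∂μ := by
          refine integral_mono_of_nonneg (.of_forall fun s => by positivity) ?_
            (.of_forall fun s => ?_)
          · exact (integrable_indicator_iff hW).2 (integrableOn_const hμ)
          · by_cases hs : s ∈ W
            · simp only [indicator_of_mem hs]
              exact (he.sum_inner_products_le (c s)).trans
                (pow_le_pow_left₀ (norm_nonneg _) (hR s) 2)
            · simp [indicator_of_notMem hs]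
      _ = _ := by
          rw [integral_indicator hW]
          simp
  · intro i _
    exact (memLp_two_iff_integrable_sq_norm
      (memLp_indicator_inner hc hR hW hμ (e i)).1).1 (memLp_indicator_inner hc hR hW hμ (e i))

end Coefficients

theorem summable_and_tsum_mul_le_of_sum_sq_le {ι : Type*} {p q : ι → ℝ} (hp : ∀ i, 0 ≤ p i)
    (hq : ∀ i, 0 ≤ q i) {A B : ℝ} (hA : ∀ t : Finset ι, ∑ i ∈ t, p i ^ 2 ≤ A)
    (hB : ∀ t : Finset ι, ∑ i ∈ t, q i ^ 2 ≤ B) :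
    (Summable fun i => p i * q i) ∧ ∑' i, p i * q i ≤ √(A * B) := by
  have h : ∀ t : Finset ι, ∑ i ∈ t, p i * q i ≤ √(A * B) := fun t => by
    refine Real.le_sqrt_of_sq_le ((Finset.sum_mul_sq_le_sq_mul_sq t p q).trans ?_)
    have hA0 : 0 ≤ A := by simpa using hA ∅
    exact mul_le_mul (hA t) (hB t) (Finset.sum_nonneg fun i _ => by positivity) hA0
  have h0 : 0 ≤ fun i => p i * q i := fun i => mul_nonneg (hp i) (hq i)
  exact ⟨summable_of_sum_le h0 h, tsum_le_of_sum_le' (Real.sqrt_nonneg _) h⟩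

/-! ### Strong continuity of the regular representation. -/

section Group

variable {G : Type*} [Group G] [TopologicalSpace G] [IsTopologicalGroup G] [LocallyCompactSpace G]
  [MeasurableSpace G] [BorelSpace G]

theorem leftRegular_coeFn (g : G) (ξ : HaarL2 G) :
    leftRegular g ξ =ᵐ[Measure.haar] fun s => ξ (g⁻¹ * s) :=
  Lp.coeFn_compMeasurePreserving ξ (measurePreserving_mul_left (Measure.haar : Measure G) g⁻¹)

theorem leftRegular_mul (g h : G) (ξ : HaarL2 G) :
    leftRegular (g * h) ξ = leftRegular g (leftRegular h ξ) := by
  refine Lp.ext ?_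
  have := (measurePreserving_mul_left (Measure.haar : Measure G) g⁻¹).quasiMeasurePreserving.ae_eq
    (leftRegular_coeFn h ξ)
  filter_upwards [leftRegular_coeFn (g * h) ξ, leftRegular_coeFn g (leftRegular h ξ), this]
    with s h1 h2 h3
  rw [h1, h2]
  simp only [Function.comp_apply] at h3
  rw [h3, mul_inv_rev, mul_assoc]

theorem continuous_leftRegular_inv (ξ : HaarL2 G) : Continuous fun s : G => leftRegular s⁻¹ ξ :=
  Continuous.compMeasurePreservingLp (g := fun s : G => (⟨fun t => s⁻¹⁻¹ * t, by fun_prop⟩ : C(G, G)))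
    continuous_const
    (ContinuousMap.curry ⟨fun p : G × G => p.1⁻¹⁻¹ * p.2, by fun_prop⟩).continuous
    (fun s => measurePreserving_mul_left _ _) (by simp)

end Group

/-! ### Fell absorption and multipliers of the Fourier algebra. -/

section Group

variable {G : Type u} [Group G] [TopologicalSpace G] [IsTopologicalGroup G] [LocallyCompactSpace G]
  [MeasurableSpace G] [BorelSpace G]

theorem leftRegular_toLp_coeFn (g : G) {c : G → ℂ} (hc : MemLp c 2 Measure.haar) :
    leftRegular g (hc.toLp c) =ᵐ[Measure.haar] fun s => c (g⁻¹ * s) :=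
  (leftRegular_coeFn g (hc.toLp c)).trans
    ((measurePreserving_mul_left (Measure.haar : Measure G) g⁻¹).quasiMeasurePreserving.ae_eq
      hc.coeFn_toLp)

/-- Apply the isometry `λ(s⁻¹)` to both sides of `⟨λ(g)f | h⟩`. As `λ(s⁻¹)λ(g) = λ((g⁻¹s)⁻¹)`, the
dependence on `g` becomes a translation of the variable `s`. -/
theorem hasSum_inner_leftRegular_inv {ι : Type*} {e : ι → HaarL2 G} {f h : HaarL2 G} {s : G}
    (hs : ∀ y, HasSum (fun i => inner ℂ (leftRegular s⁻¹ h) (e i) * inner ℂ (e i) y)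
      (inner ℂ (leftRegular s⁻¹ h) y)) (g : G) :
    HasSum (fun i => inner ℂ (inner ℂ (e i) (leftRegular s⁻¹ h))
      (inner ℂ (e i) (leftRegular (g⁻¹ * s)⁻¹ f))) (regularCoeff f h g) := by
  have := hs (leftRegular s⁻¹ (leftRegular g f))
  rw [LinearIsometry.inner_map_map] at this
  refine this.congr_fun fun i => ?_
  rw [RCLike.inner_apply, inner_conj_symm, mul_inv_rev, inv_inv, leftRegular_mul, mul_comm]

/-- Fell absorption: the product of `g ↦ μ(L ∩ gV) = ⟨λ(g) 1_V | 1_L⟩` with a coefficient of the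
left regular representation is a sum of coefficients of the left regular representation. -/
theorem exists_hasSum_regularCoeff_mul {V L : Set G} (hV : MeasurableSet V)
    (hVf : (Measure.haar : Measure G) V ≠ ⊤) (hL : MeasurableSet L) (hLc : IsCompact L)
    (f h : HaarL2 G) :
    ∃ (ι : Type u) (_ : Countable ι) (a b : ι → HaarL2 G),
      (Summable fun i => ‖a i‖ * ‖b i‖) ∧
      ∑' i, ‖a i‖ * ‖b i‖ ≤
        √((Measure.haar : Measure G).real V * (Measure.haar : Measure G).real L) * (‖f‖ * ‖h‖) ∧
      ∀ g, HasSum (fun i => regularCoeff (a i) (b i) g)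
        (((Measure.haar : Measure G).real (L ∩ (g⁻¹ * ·) ⁻¹' V) : ℂ) * regularCoeff f h g) := by
  set μ : Measure G := Measure.haar with hμ
  have hLf : μ L ≠ ⊤ := hLc.measure_lt_top.ne
  -- Only the vectors `λ(s⁻¹)h` with `s ∈ L` need expanding. They form a compact, hence separable,
  -- set, so a countable family suffices even if `L²(G)` is not separable.
  obtain ⟨ι, hι, e, he, hsum⟩ := exists_countable_orthonormal_hasSum_inner
    (hLc.image (continuous_leftRegular_inv h)).isSeparable
  have hcf := continuous_leftRegular_inv f
  have hch := continuous_leftRegular_inv h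
  have hRf : ∀ s : G, ‖leftRegular s⁻¹ f‖ ≤ ‖f‖ := fun s => (LinearIsometry.norm_map _ _).le
  have hRh : ∀ s : G, ‖leftRegular s⁻¹ h‖ ≤ ‖h‖ := fun s => (LinearIsometry.norm_map _ _).le
  set a : ι → HaarL2 G := fun i => (memLp_indicator_inner hcf hRf hV hVf (e i)).toLp _ with ha
  set b : ι → HaarL2 G := fun i => (memLp_indicator_inner hch hRh hL hLf (e i)).toLp _ with hb
  have hA : ∀ t : Finset ι, ∑ i ∈ t, ‖a i‖ ^ 2 ≤ μ.real V * ‖f‖ ^ 2 :=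
    sum_norm_sq_toLp_le hcf hRf hV hVf he
  have hB : ∀ t : Finset ι, ∑ i ∈ t, ‖b i‖ ^ 2 ≤ μ.real L * ‖h‖ ^ 2 :=
    sum_norm_sq_toLp_le hch hRh hL hLf he
  obtain ⟨h1, h2⟩ := summable_and_tsum_mul_le_of_sum_sq_le (fun i => norm_nonneg (a i))
    (fun i => norm_nonneg (b i)) hA hB
  refine ⟨ι, hι, a, b, h1, h2.trans_eq ?_, fun g => ?_⟩
  · rw [show μ.real V * ‖f‖ ^ 2 * (μ.real L * ‖h‖ ^ 2) =
      μ.real V * μ.real L * (‖f‖ * ‖h‖) ^ 2 by ring, Real.sqrt_mul (by positivity),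
      Real.sqrt_sq (by positivity)]
  have hsA : Summable fun i => ‖a i‖ ^ 2 := summable_of_sum_le (fun i => by positivity) hA
  have hsB : Summable fun i => ‖b i‖ ^ 2 := summable_of_sum_le (fun i => by positivity) hB
  -- Sum and integral are exchanged; the summable bound `‖b i‖² + ‖a i‖²` comes from Bessel.
  have key := hasSum_integral_of_summable_integral_norm (μ := μ)
    (F := fun i s => inner ℂ (b i s) (leftRegular g (a i) s))
    (fun i => L2.integrable_inner (b i) (leftRegular g (a i))) (by
      refine Summable.of_nonneg_of_le (fun i => integral_nonneg fun s => norm_nonneg _)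
        (fun i => integral_norm_inner_le (b i) (leftRegular g (a i))) ?_
      simpa only [LinearIsometry.norm_map] using hsB.add hsA)
  simp_rw [← L2.inner_def] at key
  -- Countability of `ι` gives one null set for all `i`; off it, the sum is Parseval on `L ∩ gV` and
  -- zero elsewhere.
  have hae : ∀ᵐ s ∂μ, ∑' i, inner ℂ (b i s) (leftRegular g (a i) s) =
      (L ∩ (g⁻¹ * ·) ⁻¹' V).indicator (fun _ => regularCoeff f h g) s := by
    have e1 : ∀ᵐ s ∂μ, ∀ i, b i s = L.indicator (fun s => inner ℂ (e i) (leftRegular s⁻¹ h)) s :=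
      ae_all_iff.2 fun i => (memLp_indicator_inner hch hRh hL hLf (e i)).coeFn_toLp
    have e2 : ∀ᵐ s ∂μ, ∀ i, leftRegular g (a i) s =
        V.indicator (fun s => inner ℂ (e i) (leftRegular s⁻¹ f)) (g⁻¹ * s) :=
      ae_all_iff.2 fun i => leftRegular_toLp_coeFn g (memLp_indicator_inner hcf hRf hV hVf (e i))
    filter_upwards [e1, e2] with s h1 h2
    simp only [h1, h2]
    by_cases hs : s ∈ L
    · by_cases hs' : g⁻¹ * s ∈ V
      · have hmem : s ∈ L ∩ (g⁻¹ * ·) ⁻¹' V := ⟨hs, hs'⟩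
        simp only [indicator_of_mem hs, indicator_of_mem hs', indicator_of_mem hmem]
        exact (hasSum_inner_leftRegular_inv (hsum _ (mem_image_of_mem _ hs)) g).tsum_eq
      · have hmem : s ∉ L ∩ (g⁻¹ * ·) ⁻¹' V := fun h => hs' h.2
        simp [indicator_of_notMem hs', indicator_of_notMem hmem]
    · have hmem : s ∉ L ∩ (g⁻¹ * ·) ⁻¹' V := fun h => hs h.1
      simp [indicator_of_notMem hs, indicator_of_notMem hmem]
  rw [integral_congr_ae hae, integral_indicator (hL.inter (hV.preimage (measurable_const_mul _))),
    setIntegral_const, Complex.real_smul] at key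
  exact key

/-- A series of coefficients over a countable index set defines an element of `A(G)`. -/
theorem exists_isFourierSeries_of_countable {ι : Type*} [Countable ι] {a b : ι → HaarL2 G}
    {u : G → ℂ} (hs : Summable fun i => ‖a i‖ * ‖b i‖)
    (hu : ∀ g, HasSum (fun i => regularCoeff (a i) (b i) g) (u g)) :
    ∃ ξ η : ℕ → HaarL2 G, IsFourierSeries u ξ η ∧
      ∑' n, ‖ξ n‖ * ‖η n‖ = ∑' i, ‖a i‖ * ‖b i‖ := by
  obtain ⟨j, hj⟩ := exists_injective_nat ι
  have h0 : ∀ n, n ∉ range j → Function.extend j a 0 n = 0 := fun n hn =>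
    Function.extend_apply' _ _ _ hn
  have hsum : HasSum (fun n => ‖Function.extend j a 0 n‖ * ‖Function.extend j b 0 n‖)
      (∑' i, ‖a i‖ * ‖b i‖) := by
    rw [← hj.hasSum_iff]
    · simpa [Function.comp_def, hj.extend_apply] using hs.hasSum
    · intro n hn
      simp [h0 n hn]
  refine ⟨Function.extend j a 0, Function.extend j b 0, ⟨hsum.summable, fun g => ?_⟩, hsum.tsum_eq⟩
  rw [← hj.hasSum_iff]
  · simpa [Function.comp_def, hj.extend_apply] using hu g
  · intro n hn
    simp [h0 n hn, regularCoeff]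

/-- If multiplication by `w` maps coefficients of norm product `r` to sums of coefficients of
total norm product at most `C * r`, then it maps `A(G)` to itself. -/
theorem exists_isFourierSeries_mul {w : G → ℂ} {C : ℝ}
    (hw : ∀ f h : HaarL2 G, ∃ (ι : Type u) (_ : Countable ι) (a b : ι → HaarL2 G),
      (Summable fun i => ‖a i‖ * ‖b i‖) ∧ ∑' i, ‖a i‖ * ‖b i‖ ≤ C * (‖f‖ * ‖h‖) ∧
      ∀ g, HasSum (fun i => regularCoeff (a i) (b i) g) (w g * regularCoeff f h g))
    {u : G → ℂ} {ξ η : ℕ → HaarL2 G} (hu : IsFourierSeries u ξ η) :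
    ∃ ξ' η' : ℕ → HaarL2 G, IsFourierSeries (w * u) ξ' η' ∧
      ∑' n, ‖ξ' n‖ * ‖η' n‖ ≤ C * ∑' n, ‖ξ n‖ * ‖η n‖ := by
  choose ι hι a b h1 h2 h3 using fun n => hw (ξ n) (η n)
  have hC : Summable fun n => C * (‖ξ n‖ * ‖η n‖) := hu.summable.mul_left C
  have hs' : Summable fun n => ∑' i, ‖a n i‖ * ‖b n i‖ :=
    Summable.of_nonneg_of_le (fun n => tsum_nonneg fun i => by positivity) h2 hC
  have hs : Summable fun p : Σ n, ι n => ‖a p.1 p.2‖ * ‖b p.1 p.2‖ :=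
    (summable_sigma_of_nonneg fun p => by positivity).2 ⟨h1, hs'⟩
  have hsum : ∀ g, HasSum (fun p : Σ n, ι n => regularCoeff (a p.1 p.2) (b p.1 p.2) g)
      ((w * u) g) := fun g => by
    have hsm : Summable fun p : Σ n, ι n => regularCoeff (a p.1 p.2) (b p.1 p.2) g :=
      Summable.of_norm_bounded hs fun p => norm_regularCoeff_le _ _ _
    rw [Pi.mul_apply, ((hu.hasSum g).mul_left (w g)).unique (hsm.hasSum.sigma fun n => h3 n g)]
    exact hsm.hasSum
  obtain ⟨ξ', η', hF, heq⟩ := exists_isFourierSeries_of_countable hs hsum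
  refine ⟨ξ', η', hF, ?_⟩
  rw [heq, hs.tsum_sigma' h1, ← tsum_mul_left]
  exact hs'.tsum_le_tsum h2 hC

namespace FourierAlgebra

/-- `w` is a bounded multiplier of `A(G)`. -/
def IsMultiplier (w : G → ℂ) : Prop :=
  ∃ T : FourierAlgebra G → FourierAlgebra G, Continuous T ∧ ∀ u g, T u g = w g * u g

theorem isMultiplier_of_bound {w : G → ℂ} {C : ℝ} (hC : 0 ≤ C)
    (hw : ∀ {u : G → ℂ} {ξ η : ℕ → HaarL2 G}, IsFourierSeries u ξ η →
      ∃ ξ' η' : ℕ → HaarL2 G, IsFourierSeries (w * u) ξ' η' ∧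
        ∑' n, ‖ξ' n‖ * ‖η' n‖ ≤ C * ∑' n, ‖ξ n‖ * ‖η n‖) :
    IsMultiplier w := by
  have hmem : ∀ u : FourierAlgebra G, w * (u : G → ℂ) ∈ fourierSubmodule G := fun u => by
    obtain ⟨ξ, η, h⟩ := u.2
    obtain ⟨ξ', η', h', -⟩ := hw h
    exact ⟨ξ', η', h'⟩
  let T : FourierAlgebra G →+ FourierAlgebra G :=
    { toFun := fun u => ⟨w * (u : G → ℂ), hmem u⟩
      map_zero' := Subtype.ext (mul_zero w)
      map_add' := fun u v => Subtype.ext (mul_add w u.1 v.1) }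
  refine ⟨T, AddMonoidHomClass.continuous_of_bound T C fun u => ?_, fun u g => rfl⟩
  refine le_of_forall_pos_le_add fun ε hε => ?_
  obtain ⟨r, ⟨ξ, η, h, rfl⟩, hr⟩ :=
    -- Dividing by `C + 1` rather than `C` covers `C = 0`.
    Real.lt_sInf_add_pos (normValues_nonempty u) (show 0 < ε / (C + 1) by positivity)
  obtain ⟨ξ', η', h', hle⟩ := hw h
  have hT : ‖T u‖ ≤ ∑' n, ‖ξ' n‖ * ‖η' n‖ :=
    csInf_le (bddBelow_normValues (T u)) ⟨ξ', η', h', rfl⟩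
  calc ‖T u‖ ≤ C * (‖u‖ + ε / (C + 1)) := hT.trans (hle.trans (by gcongr; exact hr.le))
    _ = C * ‖u‖ + C / (C + 1) * ε := by ring
    _ ≤ C * ‖u‖ + ε := by
      have : C / (C + 1) ≤ 1 := (div_le_one (by positivity)).2 (by linarith)
      nlinarith

/-- `A(G)` has compactly supported local units, acting as bounded multipliers. -/
theorem exists_isMultiplier_eq_one [T2Space G] {K U : Set G} (hK : IsCompact K) (hU : IsOpen U)
    (hKU : K ⊆ U) :
    ∃ w : G → ℂ, IsMultiplier w ∧ (∃ W, IsOpen W ∧ K ⊆ W ∧ ∀ g ∈ W, w g = 1) ∧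
      tsupport w ⊆ U := by
  -- The sets are chosen so that `K` lies in the interior of `K'` and `K'VV⁻¹ ⊆ U`.
  obtain ⟨K', hK', hKK', hK'U⟩ := exists_compact_between hK hU hKU
  obtain ⟨N, hN, hNU⟩ := compact_open_separated_mul_right hK' hU hK'U
  obtain ⟨N', hN', hNN'⟩ : ∃ N' ∈ 𝓝 (1 : G), ∀ x ∈ N', ∀ y ∈ N', x * y⁻¹ ∈ N := by
    obtain ⟨N', hN', h⟩ := exists_nhds_split_inv hN
    exact ⟨N', hN', fun x hx y hy => by simpa [div_eq_mul_inv] using h x hx y hy⟩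
  obtain ⟨V, hV, hVN', hVc⟩ := local_compact_nhds hN'
  set μ : Measure G := Measure.haar with hμ
  have hμV : 0 < μ.real V :=
    ENNReal.toReal_pos (Measure.measure_pos_of_mem_nhds μ hV).ne' hVc.measure_lt_top.ne
  have hL : IsCompact (K' * V) := hK'.mul hVc
  -- For `g ∈ K'` the set `gV` lies in `K'V`, so the value is `μ(V)`; it can be nonzero only for `g
  -- ∈ K'VV⁻¹`.
  set w₀ : G → ℂ := fun g => (μ.real (K' * V ∩ (g⁻¹ * ·) ⁻¹' V) : ℂ) with hw₀
  set w : G → ℂ := (μ.real V : ℂ)⁻¹ • w₀ with hw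
  have hsub : Function.support w ⊆ K' * V * V⁻¹ := by
    intro g hg
    have hne : (K' * V ∩ (g⁻¹ * ·) ⁻¹' V).Nonempty := by
      by_contra hne
      rw [not_nonempty_iff_eq_empty] at hne
      exact hg (by simp [hw, hw₀, hne])
    obtain ⟨s, hs, hs'⟩ := hne
    exact ⟨s, hs, (g⁻¹ * s)⁻¹, inv_mem_inv.2 hs', by simp⟩
  have hVV : K' * V * V⁻¹ ⊆ U := by
    rw [mul_assoc]
    refine (mul_subset_mul_left ?_).trans hNU
    rintro _ ⟨x, hx, y, hy, rfl⟩
    simpa using hNN' x (hVN' hx) y⁻¹ (hVN' hy)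
  refine ⟨w, isMultiplier_of_bound (C := (μ.real V)⁻¹ * √(μ.real V * μ.real (K' * V)))
    (by positivity) fun {u ξ η} hu => ?_, ⟨interior K', isOpen_interior, hKK', fun g hg => ?_⟩, ?_⟩
  · obtain ⟨ξ', η', h', hle⟩ := exists_isFourierSeries_mul
      (exists_hasSum_regularCoeff_mul hVc.measurableSet hVc.measure_lt_top.ne hL.measurableSet hL) hu
    refine ⟨_, η', by rw [hw, smul_mul_assoc]; exact h'.smul _, ?_⟩
    simp only [Pi.smul_apply, norm_smul, mul_assoc, tsum_mul_left]
    rw [norm_inv, Complex.norm_real, Real.norm_of_nonneg hμV.le]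
    gcongr
  · have hsubset : (g⁻¹ * ·) ⁻¹' V ⊆ K' * V := fun s hs =>
      ⟨g, interior_subset hg, g⁻¹ * s, hs, by simp⟩
    have : μ.real ((g⁻¹ * ·) ⁻¹' V) = μ.real V := by
      simp [measureReal_def, measure_preimage_mul]
    simp [hw, hw₀, inter_eq_right.2 hsubset, this, hμV.ne']
  · exact (closure_minimal hsub (hL.mul hVc.inv).isClosed).trans hVV

end FourierAlgebra

end Group

/-! ### Localization and local synthesis. -/

section Synthesis

variable {G : Type*} [Group G] [TopologicalSpace G] [IsTopologicalGroup G] [LocallyCompactSpace G]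
  [MeasurableSpace G] [BorelSpace G]

namespace FourierAlgebra

theorem mem_compactlySupported_of_subset {u v : FourierAlgebra G} {S : Set G}
    (hu : u ∈ compactlySupported G) (hS : tsupport (v : G → ℂ) ⊆ tsupport (u : G → ℂ) \ S) :
    v ∈ compactlySupported G :=
  IsCompact.of_isClosed_subset hu (isClosed_tsupport _) (hS.trans sdiff_subset)

theorem tsupport_mul_subset {u v : FourierAlgebra G} {w : G → ℂ} (h : ∀ g, v g = w g * u g) :
    tsupport (v : G → ℂ) ⊆ tsupport (u : G → ℂ) \ (tsupport w)ᶜ := by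
  have h' : (v : G → ℂ) = w * (u : G → ℂ) := funext h
  rw [sdiff_compl, h']
  exact subset_inter (tsupport_mul_subset_right) (tsupport_mul_subset_left)

theorem tsupport_sub_subset {u v : FourierAlgebra G} {W : Set G} (hW : IsOpen W)
    (h : ∀ g ∈ W, v g = u g) (h' : ∀ g, u g = 0 → v g = 0) :
    tsupport (u - v : FourierAlgebra G).1 ⊆ tsupport (u : G → ℂ) \ W := by
  refine closure_minimal (fun g hg => ?_) ((isClosed_tsupport _).sdiff hW)
  have hg : u g - v g ≠ 0 := hg
  refine ⟨subset_tsupport _ fun h0 => hg ?_, fun hgW => hg ?_⟩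
  · rw [h0, h' g h0, sub_zero]
  · rw [h g hgW, sub_self]

theorem supportedOff_subset (E : Set G) :
    supportedOff E ⊆ vanishing E ∩ compactlySupported G := fun _ hu =>
  ⟨fun g hg => by_contra fun h =>
    (hu.2 ▸ ⟨subset_tsupport _ h, hg⟩ : g ∈ (∅ : Set G)), hu.1⟩

theorem supportedOff_anti {E F : Set G} (h : F ⊆ E) :
    supportedOff E ⊆ supportedOff F := fun _ hu =>
  ⟨hu.1, subset_empty_iff.1 (hu.2 ▸ inter_subset_inter_right _ h)⟩

theorem add_mem_supportedOff {E : Set G} {u v : FourierAlgebra G} (hu : u ∈ supportedOff E)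
    (hv : v ∈ supportedOff E) : u + v ∈ supportedOff E := by
  refine ⟨HasCompactSupport.add hu.1 hv.1, subset_empty_iff.1 ?_⟩
  have : tsupport (u + v : FourierAlgebra G).1 ⊆ tsupport (u : G → ℂ) ∪ tsupport (v : G → ℂ) :=
    tsupport_add (u : G → ℂ) (v : G → ℂ)
  rintro g ⟨hg, hgE⟩
  rcases this hg with h | h
  · exact hu.2 ▸ ⟨h, hgE⟩
  · exact hv.2 ▸ ⟨h, hgE⟩

theorem add_mem_closure_supportedOff {E : Set G} {u v : FourierAlgebra G}
    (hu : u ∈ closure (supportedOff E)) (hv : v ∈ closure (supportedOff E)) :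
    u + v ∈ closure (supportedOff E) :=
  map_mem_closure₂ continuous_add hu hv fun _ h _ h' => add_mem_supportedOff h h'

theorem isLocalSynthesis_iff (E : Set G) :
    IsLocalSynthesis E ↔ ∀ u ∈ vanishing E, u ∈ compactlySupported G →
      u ∈ closure (supportedOff E) := by
  refine ⟨fun h u hu hc => ?_, fun h => ?_⟩
  · rw [show closure (supportedOff E) = closedVanishing E from h]
    exact subset_closure ⟨hu, hc⟩
  · exact (closure_mono (supportedOff_subset E)).antisymm
      (closure_minimal (fun u hu => h u hu.1 hu.2) isClosed_closure)

/-- Localization of `u ∈ A_c(G)` at a subset `F` of `E` that is closed, with `E \ F` closed. -/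
theorem exists_localization [T2Space G] {E F : Set G} (hF : IsClosed F)
    (hEF : IsClosed (E \ F)) {u : FourierAlgebra G} (hu : u ∈ compactlySupported G) :
    ∃ (w : G → ℂ) (T : FourierAlgebra G → FourierAlgebra G), Continuous T ∧
      (∀ v g, T v g = w g * v g) ∧ tsupport w ∩ E ⊆ F ∧
      tsupport (u - T u : FourierAlgebra G).1 ⊆ tsupport (u : G → ℂ) \ F := by
  obtain ⟨w, ⟨T, hT, hTw⟩, ⟨W, hWo, hKW, hW1⟩, hwU⟩ :=
    exists_isMultiplier_eq_one (K := tsupport (u : G → ℂ) ∩ F) (U := (E \ F)ᶜ)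
      (IsCompact.inter_right hu hF) hEF.isOpen_compl fun g hg h => h.2 hg.2
  refine ⟨w, T, hT, hTw, fun g hg => by_contra fun h => hwU hg.1 ⟨hg.2, h⟩, fun g hg => ?_⟩
  obtain ⟨h1, h2⟩ := tsupport_sub_subset hWo (fun g hg => by rw [hTw, hW1 g hg, one_mul])
    (fun g hg => by rw [hTw, hg, mul_zero]) hg
  exact ⟨h1, fun h => h2 (hKW ⟨h1, h⟩)⟩

theorem isLocalSynthesis_of_isClosed_sdiff [T2Space G] {E F : Set G} (hFE : F ⊆ E)
    (hF : IsClosed F) (hEF : IsClosed (E \ F)) (hE : IsLocalSynthesis E) :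
    IsLocalSynthesis F := by
  rw [isLocalSynthesis_iff] at hE ⊢
  intro u hu hc
  obtain ⟨w, T, hT, hTw, hwF, hsub⟩ := exists_localization hF hEF hc
  rw [← add_sub_cancel (T u) u]
  -- `T u` vanishes on all of `E`, so synthesis for `E` applies to it; `u - T u` is already
  -- supported off `F`.
  refine add_mem_closure_supportedOff (closure_mono (supportedOff_anti hFE) (hE _ ?_ ?_))
    (subset_closure ⟨mem_compactlySupported_of_subset hc hsub, ?_⟩)
  · intro g hg
    rw [hTw]
    by_cases h : g ∈ tsupport w
    · rw [hu g (hwF ⟨h, hg⟩), mul_zero]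
    · rw [image_eq_zero_of_notMem_tsupport h, zero_mul]
  · exact mem_compactlySupported_of_subset hc (tsupport_mul_subset (hTw u))
  · exact subset_empty_iff.1 fun g hg => (hsub hg.1).2 hg.2

/-- Induction on the cover, with `u` quantified inside because the remainder `u - T u`, which needs
one piece fewer, replaces it. -/
theorem mem_closure_supportedOff_of_finset_cover [T2Space G] {I : Type*} {E : Set G}
    {F : I → Set G} (hF : ∀ i, IsClosed (F i)) (hFE : ∀ i, F i ⊆ E)
    (hEF : ∀ i, IsClosed (E \ F i)) (hs : ∀ i, IsLocalSynthesis (F i)) (t : Finset I) :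
    ∀ u ∈ vanishing E, u ∈ compactlySupported G → tsupport (u : G → ℂ) ∩ E ⊆ ⋃ i ∈ t, F i →
      u ∈ closure (supportedOff E) := by
  classical
  induction t using Finset.induction_on with
  | empty =>
    intro u _ hc hsub
    exact subset_closure ⟨hc, subset_empty_iff.1 (by simpa using hsub)⟩
  | insert i t _ ih =>
    intro u hu hc hsub
    obtain ⟨w, T, hT, hTw, hwF, hsub'⟩ := exists_localization (hF i) (hEF i) hc
    rw [← add_sub_cancel (T u) u]
    refine add_mem_closure_supportedOff ?_
      (ih _ ?_ (mem_compactlySupported_of_subset hc hsub') fun g hg => ?_)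
    -- Approximate `u` off `F i`, then apply the continuous map `T`: the support of `T v` can meet
    -- `E` only in `F i`, which `supp v` misses.
    · refine map_mem_closure hT
        ((isLocalSynthesis_iff _).1 (hs i) u (fun g hg => hu g (hFE i hg)) hc) fun v hv => ?_
      have hv' := tsupport_mul_subset (hTw v)
      rw [sdiff_compl] at hv'
      refine ⟨mem_compactlySupported_of_subset hv.1 (tsupport_mul_subset (hTw v)),
        subset_empty_iff.1 fun g hg => ?_⟩
      exact hv.2 ▸ ⟨(hv' hg.1).1, hwF ⟨(hv' hg.1).2, hg.2⟩⟩
    · intro g hg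
      change u g - T u g = 0
      rw [hTw, hu g hg, mul_zero, sub_zero]
    · have := hsub ⟨(hsub' hg.1).1, hg.2⟩
      rw [Finset.set_biUnion_insert] at this
      exact this.resolve_left (hsub' hg.1).2

end FourierAlgebra

end Synthesis

theorem mainTheorem12 {G : Type*} [Group G] [TopologicalSpace G] [IsTopologicalGroup G]
    [LocallyCompactSpace G] [T2Space G] [MeasurableSpace G] [BorelSpace G]
    {I : Type*} (E : Set G) (hE : IsClosed E) (F : I → Set G)
    (hF_union : E = ⋃ i, F i) (hF_disjoint : Pairwise fun i j => Disjoint (F i) (F j))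
    (hF_closed : ∀ i, IsClosed (F i)) (hF_open : ∀ i, ∃ U : Set G, IsOpen U ∧ F i = E ∩ U) :
    IsLocalSynthesis E ↔ ∀ i, IsLocalSynthesis (F i) := by
  choose U hU hFU using hF_open
  have hFE : ∀ i, F i ⊆ E := fun i => hF_union ▸ subset_iUnion F i
  have hEF : ∀ i, IsClosed (E \ F i) := fun i => by
    rw [hFU i, sdiff_self_inter]
    exact hE.sdiff (hU i)
  refine ⟨fun h i => FourierAlgebra.isLocalSynthesis_of_isClosed_sdiff (hFE i) (hF_closed i)
    (hEF i) h, fun h => (FourierAlgebra.isLocalSynthesis_iff E).2 fun u hu hc => ?_⟩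
  obtain ⟨t, ht⟩ := (IsCompact.inter_right hc hE).elim_finite_subcover U hU fun g hg => by
    obtain ⟨i, hi⟩ := mem_iUnion.1 (hF_union ▸ hg.2)
    exact mem_iUnion.2 ⟨i, (hFU i ▸ hi : g ∈ E ∩ U i).2⟩
  refine FourierAlgebra.mem_closure_supportedOff_of_finset_cover hF_closed hFE hEF h t u hu hc
    fun g hg => ?_
  obtain ⟨i, hi, hg'⟩ := mem_iUnion₂.1 (ht hg)
  exact mem_iUnion₂.2 ⟨i, hi, hFU i ▸ ⟨hg.2, hg'⟩⟩
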